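/- **Theorem 2.3 (Weighted ABP Maximum Principle).** Let $0<\lambda,\Lambda<\infty$. There is a constant $C>0$ depending only on $\lambda$ and $\Lambda$ with the following property. Let $\Omega\subset\mathbb R^2$ be a bounded open set, $d=\operatorname{diam}(\Omega)$ its Euclidean diameter, and let $a_{11},a_{12},a_{22}$ be real functions satisfying, for all $x\in\Omega$ and all $\xi=(\xi_1,\xi_2)\in\mathbb R^2$, $$\lambda(\xi_1^2+\xi_2^2)\le a_{11}(x)\xi_1^2+2a_{12}(x)\xi_1\xi_2+a_{22}(x)\xi_2^2\le\Lambda(\xi_1^2+\xi_2^2).$$ Let $X_1=\partial_{x_1}$, $X_2=x_1\partial_{x_2}$ and $$L=a_{11}X_1^2+2a_{12}X_2X_1+a_{22}X_2^2 .$$ Let $f$ be a bounded measurable function on $\Omega$ and let $u\in C^2(\Omega)\cap C(\overline\Omega)$ satisfy $u\ge0$ on $\partial\Omega$ and $Lu(x)\le f(x)\,x_1^2$ for all $x\in\Omega$. Extend $u$ by $0$ outside $\Omega$, put $u^-=\max\{-u,0\}$ and $f^+=\max\{f,0\}$, let $B$ be any Euclidean ball of radius $2d$ with $\Omega\subset B$,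 and let $\Gamma_u$ be the convex envelope of $-u^-$ in $B$, that is, $$\Gamma_u(x)=\sup\{\ell(x):\ \ell \text{ affine},\ \ell\le -u^-\text{ in }B\},\qquad x\in B.$$ Then $$\sup_{\Omega}u^-\le C\,\operatorname{diam}(\Omega)\left(\int_{\Omega\cap\{u=\Gamma_u\}}\bigl(f^+(x)\bigr)^2x_1^2\,dx\right)^{1/2}.$$ -/

import Mathlib

open MeasureTheory

noncomputable section

namespace GrushinABP

/-- The Euclidean plane; the coordinates `x₁, x₂` of the mathematics are `x 0, x 1`. -/
abbrev Plane : Type := EuclideanSpace ℝ (Fin 2)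

/-- The Grushin vector field `X₁ = ∂_{x₁}`, acting on functions. -/
def X₁ (v : Plane → ℝ) (x : Plane) : ℝ :=
  fderiv ℝ v x (EuclideanSpace.single 0 1)

/-- The Grushin vector field `X₂ = x₁ ∂_{x₂}`, acting on functions. -/
def X₂ (v : Plane → ℝ) (x : Plane) : ℝ :=
  x 0 * fderiv ℝ v x (EuclideanSpace.single 1 1)

/-- The operator `L = a₁₁ X₁² + 2 a₁₂ X₂ X₁ + a₂₂ X₂²`. -/
def grushinL (a₁₁ a₁₂ a₂₂ : Plane → ℝ) (u : Plane → ℝ) (x : Plane) : ℝ :=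
  a₁₁ x * X₁ (X₁ u) x + 2 * a₁₂ x * X₂ (X₁ u) x + a₂₂ x * X₂ (X₂ u) x

/-- Uniform ellipticity in `Ω`, with constants `lam` and `Lam`, of the symmetric matrix with
entries `a₁₁, a₁₂, a₂₂`. -/
def IsElliptic (lam Lam : ℝ) (Ω : Set Plane) (a₁₁ a₁₂ a₂₂ : Plane → ℝ) : Prop :=
  ∀ x ∈ Ω, ∀ ξ₁ ξ₂ : ℝ,
    lam * (ξ₁ ^ 2 + ξ₂ ^ 2) ≤ a₁₁ x * ξ₁ ^ 2 + 2 * a₁₂ x * ξ₁ * ξ₂ + a₂₂ x * ξ₂ ^ 2 ∧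
    a₁₁ x * ξ₁ ^ 2 + 2 * a₁₂ x * ξ₁ * ξ₂ + a₂₂ x * ξ₂ ^ 2 ≤ Lam * (ξ₁ ^ 2 + ξ₂ ^ 2)

/-- The negative part `v⁻ = max {-v, 0}`. -/
def negPt (v : Plane → ℝ) (x : Plane) : ℝ := max (-v x) 0

/-- The positive part `v⁺ = max {v, 0}`. -/
def posPt (v : Plane → ℝ) (x : Plane) : ℝ := max (v x) 0

/-- The convex envelope of `w` in `B`: the supremum of the affine functions lying below `w`
in `B`. It is used only for `w` bounded below on `B` and at points of `B`, where the set of values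
is nonempty and bounded above. -/
def convexEnvelope (B : Set Plane) (w : Plane → ℝ) (x : Plane) : ℝ :=
  sSup {t : ℝ | ∃ l : Plane →ᵃ[ℝ] ℝ, (∀ y ∈ B, l y ≤ w y) ∧ t = l x}

/-- `Γ_u`: the convex envelope in `B` of `-u⁻`, where `u` is extended by `0` outside `Ω`. -/
def Gam (Ω B : Set Plane) (u : Plane → ℝ) : Plane → ℝ :=
  convexEnvelope B (fun y => -negPt (Ω.indicator u) y)

/-- The part `Ω ∩ {u = Γ_u}` of the contact set that lies in `Ω`. -/
def contactSet (Ω B : Set Plane) (u : Plane → ℝ) : Set Plane :=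
  {x | x ∈ Ω ∧ u x = Gam Ω B u x}

end GrushinABP

end

namespace GrushinABP

open scoped Topology
open Filter

/-! This is the Alexandrov argument, run on points where the tangent plane of `u` itself lies below
`-u⁻` in `B` (`tangentSet`); no regularity of the envelope is needed. If `u x₀ < 0`, sliding a plane
of slope `p`, `|p| < -u x₀ / (4d)`, up from below touches `u` inside `Ω`, so gradients over this set
cover a ball (`ball_subset_gradient_image`). The area inequality bounds the ball's area by the
integral of `|det D²u|`. There `D²u` is positive semidefinite, and the determinant-trace inequality
for the Grushin matrix gives `4 lam² x₁² det D²u ≤ (Lu)² ≤ (f⁺ x₁²)²` (`abs_det_hessian_le`).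
Cancelling `x₁²`, legitimate off a null line, leaves the weight `x₁²`. -/

/-- Second order necessary condition for a local minimum on the line. -/
theorem deriv_deriv_nonneg_of_isLocalMin {g : ℝ → ℝ} {a : ℝ} (h : IsLocalMin g a)
    (hc : ContinuousAt g a) : 0 ≤ deriv (deriv g) a := by
  by_contra! hneg
  have hmax := isLocalMax_of_deriv_deriv_neg hneg h.deriv_eq_zero hc
  have hconst : g =ᶠ[𝓝 a] fun _ => g a := by
    filter_upwards [h, hmax] with t h₁ h₂ using le_antisymm h₂ h₁
  have : deriv (deriv g) a = 0 := by
    rw [hconst.deriv.deriv_eq]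
    simp
  linarith

/-- The second derivative of a `C²` function which lies locally above its tangent plane is
positive semidefinite. -/
theorem fderiv_fderiv_nonneg_of_tangent_le {E : Type*} [NormedAddCommGroup E] [NormedSpace ℝ E]
    {u : E → ℝ} {x : E} (hu : ContDiffAt ℝ 2 u x)
    (h : ∀ᶠ y in 𝓝 x, u x + fderiv ℝ u x (y - x) ≤ u y) (v : E) :
    0 ≤ fderiv ℝ (fderiv ℝ u) x v v := by
  have hline : ∀ t : ℝ, HasDerivAt (fun t : ℝ => x + t • v) v t := fun t => by
    simpa using ((hasDerivAt_id t).smul_const v).const_add x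
  have htend : Tendsto (fun t : ℝ => x + t • v) (𝓝 0) (𝓝 x) := by
    simpa using (hline 0).continuousAt.tendsto
  have hd : ∀ᶠ t : ℝ in 𝓝 0, DifferentiableAt ℝ u (x + t • v) :=
    htend.eventually ((hu.eventually (by simp)).mono fun y hy => hy.differentiableAt (by simp))
  set g : ℝ → ℝ := fun t => u (x + t • v) - t * fderiv ℝ u x v with hg
  have hg' : deriv g =ᶠ[𝓝 0] fun t => fderiv ℝ u (x + t • v) v - fderiv ℝ u x v := by
    filter_upwards [hd] with t ht
    have h₁ := ht.hasFDerivAt.comp_hasDerivAt t (hline t)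
    exact (h₁.sub (hasDerivAt_mul_const (fderiv ℝ u x v))).deriv
  have hu' : DifferentiableAt ℝ (fderiv ℝ u) x :=
    (hu.fderiv_right (m := 1) (by norm_num)).differentiableAt (by simp)
  have hg'' : deriv (deriv g) 0 = fderiv ℝ (fderiv ℝ u) x v v := by
    rw [hg'.deriv_eq]
    have hx : HasFDerivAt (fderiv ℝ u) (fderiv ℝ (fderiv ℝ u) x) (x + (0 : ℝ) • v) := by
      simpa using hu'.hasFDerivAt
    have h₂ : HasDerivAt (fun t : ℝ => fderiv ℝ u (x + t • v)) (fderiv ℝ (fderiv ℝ u) x v) 0 :=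
      hx.comp_hasDerivAt (0 : ℝ) (hline 0)
    have h₃ : HasDerivAt (fun t : ℝ => fderiv ℝ u (x + t • v) v)
        (fderiv ℝ (fderiv ℝ u) x v v) 0 :=
      (ContinuousLinearMap.apply ℝ ℝ v).hasFDerivAt.comp_hasDerivAt (0 : ℝ) h₂
    exact (h₃.sub_const (fderiv ℝ u x v)).deriv
  rw [← hg'']
  refine deriv_deriv_nonneg_of_isLocalMin ?_ ?_
  · filter_upwards [htend.eventually h] with t ht
    simp only [add_sub_cancel_left, map_smul, smul_eq_mul] at ht
    simp only [hg, zero_smul, add_zero, zero_mul, sub_zero]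
    linarith
  · have : ContinuousAt (fun t : ℝ => u (x + t • v)) 0 :=
      ContinuousAt.comp (g := u) (by simpa using hu.continuousAt) (hline 0).continuousAt
    exact this.sub (by fun_prop)

/-- For a positive semidefinite `D` with entries `p, q, r` and the Grushin coefficient matrix `A`
with entries `a, b t, c t²`, one has `4 lam² t² det D ≤ 4 det A det D ≤ (tr (A D))²`. -/
theorem det_mul_le_trace_sq {lam a b c t p q r : ℝ} (hlam : 0 < lam)
    (hell : ∀ ξ₁ ξ₂ : ℝ, lam * (ξ₁ ^ 2 + ξ₂ ^ 2) ≤ a * ξ₁ ^ 2 + 2 * b * ξ₁ * ξ₂ + c * ξ₂ ^ 2)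
    (hD : ∀ ξ₁ ξ₂ : ℝ, 0 ≤ p * ξ₁ ^ 2 + 2 * q * ξ₁ * ξ₂ + r * ξ₂ ^ 2) :
    0 ≤ p * r - q ^ 2 ∧ 0 ≤ a * p + 2 * b * (t * q) + c * (t ^ 2 * r) ∧
      4 * lam ^ 2 * t ^ 2 * (p * r - q ^ 2) ≤
        (a * p + 2 * b * (t * q) + c * (t ^ 2 * r)) ^ 2 := by
  have psd : ∀ {p q r : ℝ}, (∀ ξ₁ ξ₂ : ℝ, 0 ≤ p * ξ₁ ^ 2 + 2 * q * ξ₁ * ξ₂ + r * ξ₂ ^ 2) →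
      0 ≤ p ∧ 0 ≤ r ∧ 0 ≤ p * r - q ^ 2 := by
    intro p q r h
    have hp : 0 ≤ p := by simpa using h 1 0
    have hr : 0 ≤ r := by simpa using h 0 1
    refine ⟨hp, hr, ?_⟩
    -- These vectors give `p (pr - q²)`, `r (pr - q²)` and, when `p = r = 0`, `-2q²`.
    have h₁ := h q (-p)
    have h₂ := h r (-q)
    have h₃ := h 1 (-q)
    by_contra! hneg
    rcases hp.eq_or_lt with rfl | hp
    · rcases hr.eq_or_lt with rfl | hr
      · nlinarith
      · nlinarith
    · nlinarith
  obtain ⟨hp, hr, hdet⟩ := psd hD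
  obtain ⟨ha, hc, hA⟩ := psd (p := a - lam) (q := b) (r := c - lam) fun ξ₁ ξ₂ => by
    have := hell ξ₁ ξ₂; nlinarith
  have hA' : lam ^ 2 ≤ a * c - b ^ 2 := by nlinarith
  have ha' : 0 < a := by linarith
  -- Completing the square writes `a tr(AD)` as `X + Y`; the bound then follows from `(X + Y)² ≥
  -- 4XY` and `X r ≥ a² det D`.
  have key : a * (a * p + 2 * b * (t * q) + c * (t ^ 2 * r)) =
      (p * a ^ 2 + 2 * q * a * (b * t) + r * (b * t) ^ 2) + (a * c - b ^ 2) * t ^ 2 * r := by ring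
  have hQ := hD a (b * t)
  have hT : 0 ≤ a * p + 2 * b * (t * q) + c * (t ^ 2 * r) := by
    refine nonneg_of_mul_nonneg_right (b := a * p + 2 * b * (t * q) + c * (t ^ 2 * r)) ?_ ha'
    rw [key]
    have : 0 ≤ a * c - b ^ 2 := le_trans (sq_nonneg _) hA'
    positivity
  refine ⟨hdet, hT, ?_⟩
  have h1 : 4 * (a * c - b ^ 2) * t ^ 2 * (p * r - q ^ 2) ≤
      (a * p + 2 * b * (t * q) + c * (t ^ 2 * r)) ^ 2 := by
    have hQr : (p * a ^ 2 + 2 * q * a * (b * t) + r * (b * t) ^ 2) * r =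
        (r * (b * t) + q * a) ^ 2 + a ^ 2 * (p * r - q ^ 2) := by ring
    have ha2 : 0 < a ^ 2 := by positivity
    refine le_of_mul_le_mul_left ?_ ha2
    rw [← mul_pow, key]
    have hdA : 0 ≤ (a * c - b ^ 2) * t ^ 2 := by
      have : 0 ≤ a * c - b ^ 2 := le_trans (sq_nonneg _) hA'
      positivity
    nlinarith [sq_nonneg ((p * a ^ 2 + 2 * q * a * (b * t) + r * (b * t) ^ 2)
      - (a * c - b ^ 2) * t ^ 2 * r), mul_nonneg hdA (sq_nonneg (r * (b * t) + q * a))]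
  refine le_trans ?_ h1
  gcongr

/-! ### Coordinates, gradients and Hessians -/

/-- The line `{x₁ = 0}` is Lebesgue null. -/
theorem volume_degenerate_line : volume {x : Plane | x 0 = 0} = 0 := by
  have h := Measure.addHaar_submodule (volume : Measure Plane)
    (LinearMap.ker (EuclideanSpace.proj (0 : Fin 2) : Plane →L[ℝ] ℝ).toLinearMap) (by
      intro h
      have : (EuclideanSpace.single 0 1 : Plane) ∈
        LinearMap.ker (EuclideanSpace.proj (0 : Fin 2) : Plane →L[ℝ] ℝ).toLinearMap := by
          rw [h]; trivial
      simp at this)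
  convert h using 2
  ext x
  simp

/-- The vector representing a linear functional on the plane in the standard coordinates. -/
noncomputable def vecOfDual : (Plane →L[ℝ] ℝ) →L[ℝ] Plane :=
  ((EuclideanSpace.equiv (Fin 2) ℝ).symm : (Fin 2 → ℝ) →L[ℝ] Plane).comp
    (ContinuousLinearMap.pi fun i => ContinuousLinearMap.apply ℝ ℝ (EuclideanSpace.single i 1))

@[simp]
theorem vecOfDual_apply (φ : Plane →L[ℝ] ℝ) (i : Fin 2) :
    vecOfDual φ i = φ (EuclideanSpace.single i 1) := rfl

theorem vecOfDual_innerSL (p : Plane) : vecOfDual (innerSL ℝ p) = p := by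
  ext i
  simp [EuclideanSpace.inner_single_right]

theorem det_vecOfDual_comp (H : Plane →L[ℝ] Plane →L[ℝ] ℝ) :
    (vecOfDual.comp H).det =
      H (EuclideanSpace.single 0 1) (EuclideanSpace.single 0 1) *
        H (EuclideanSpace.single 1 1) (EuclideanSpace.single 1 1) -
      H (EuclideanSpace.single 0 1) (EuclideanSpace.single 1 1) *
        H (EuclideanSpace.single 1 1) (EuclideanSpace.single 0 1) := by
  rw [ContinuousLinearMap.det,
    ← LinearMap.det_toMatrix (EuclideanSpace.basisFun (Fin 2) ℝ).toBasis, Matrix.det_fin_two]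
  simp [LinearMap.toMatrix_apply]
  ring

/-- The Grushin operator on `C²` functions in terms of the second derivative. -/
theorem grushinL_eq {a₁₁ a₁₂ a₂₂ u : Plane → ℝ} {x : Plane} (hu : ContDiffAt ℝ 2 u x) :
    grushinL a₁₁ a₁₂ a₂₂ u x =
      a₁₁ x * fderiv ℝ (fderiv ℝ u) x (EuclideanSpace.single 0 1) (EuclideanSpace.single 0 1) +
      2 * a₁₂ x * (x 0 *
        fderiv ℝ (fderiv ℝ u) x (EuclideanSpace.single 1 1) (EuclideanSpace.single 0 1)) +
      a₂₂ x * (x 0 ^ 2 *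
        fderiv ℝ (fderiv ℝ u) x (EuclideanSpace.single 1 1) (EuclideanSpace.single 1 1)) := by
  have hu' : DifferentiableAt ℝ (fderiv ℝ u) x :=
    (hu.fderiv_right (m := 1) (by norm_num)).differentiableAt (by simp)
  have h : ∀ v : Plane, HasFDerivAt (fun y => fderiv ℝ u y v)
      ((fderiv ℝ (fderiv ℝ u) x).flip v) x := fun v => by
    simpa using hu'.hasFDerivAt.clm_apply (hasFDerivAt_const v x)
  have h0 : HasFDerivAt (fun y : Plane => y 0)
      (EuclideanSpace.proj (0 : Fin 2) : Plane →L[ℝ] ℝ) x :=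
    (EuclideanSpace.proj (0 : Fin 2) : Plane →L[ℝ] ℝ).hasFDerivAt
  have e1 : fderiv ℝ (X₁ u) x = _ := (h (EuclideanSpace.single 0 1)).fderiv
  have e2 : fderiv ℝ (X₂ u) x = _ := (h0.mul (h (EuclideanSpace.single 1 1))).fderiv
  unfold grushinL
  rw [X₁, X₂, X₂, e1, e2]
  simp [-mul_eq_mul_left_iff]
  ring

/-! ### Tangent planes and the gradient image -/

/-- The points of `Ω` at which the tangent plane of `u` lies below `-u⁻` in `B`. -/
def tangentSet (Ω B : Set Plane) (u : Plane → ℝ) : Set Plane :=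
  {x | x ∈ Ω ∧ ∀ y ∈ B, u x + fderiv ℝ u x (y - x) ≤ -negPt (Ω.indicator u) y}

/-- The tangent plane competes in the envelope and attains `u x`; since `-u⁻ ≤ u` on `Ω`, no
competitor exceeds it. -/
theorem tangentSet_subset_contactSet {Ω B : Set Plane} (hΩB : Ω ⊆ B) (u : Plane → ℝ) :
    tangentSet Ω B u ⊆ contactSet Ω B u := by
  rintro x ⟨hx, h⟩
  refine ⟨hx, ?_⟩
  have hxB := hΩB hx
  have hw : -negPt (Ω.indicator u) x ≤ u x := by
    rw [negPt, Set.indicator_of_mem hx]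
    linarith [le_max_left (-u x) 0]
  have hg : IsGreatest {t : ℝ | ∃ l : Plane →ᵃ[ℝ] ℝ,
      (∀ y ∈ B, l y ≤ -negPt (Ω.indicator u) y) ∧ t = l x} (u x) := by
    constructor
    · refine ⟨(fderiv ℝ u x).toLinearMap.toAffineMap +
        AffineMap.const ℝ Plane (u x - fderiv ℝ u x x), fun y hy => ?_, by simp⟩
      have := h y hy
      rw [map_sub] at this
      simp only [AffineMap.coe_add, Pi.add_apply, LinearMap.coe_toAffineMap,
        ContinuousLinearMap.coe_coe, AffineMap.const_apply]
      linarith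
    · rintro t ⟨l, hl, rfl⟩
      exact (hl x hxB).trans hw
  exact hg.csSup_eq.symm

theorem measurableSet_tangentSet {Ω B : Set Plane} {u : Plane → ℝ} (hΩ : IsOpen Ω)
    (hu : ContDiffOn ℝ 2 u Ω) : MeasurableSet (tangentSet Ω B u) := by
  have hcont : ∀ y, ContinuousOn (fun x => u x + fderiv ℝ u x (y - x)) Ω := fun y =>
    hu.continuousOn.add ((hu.continuousOn_fderiv_of_isOpen hΩ (by norm_num)).clm_apply
      (by fun_prop))
  -- Each `y` imposes a condition closed in `x`, so the set is relatively closed however irregular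
  -- the right-hand side is in `y`.
  have hclosed : IsClosed {x : Ω | ∀ y ∈ B,
      u x + fderiv ℝ u x (y - x) ≤ -negPt (Ω.indicator u) y} := by
    simp only [Set.ofPred_forall]
    exact isClosed_iInter fun y => isClosed_iInter fun _ =>
      isClosed_le (hcont y).domRestrict continuous_const
  convert (MeasurableEmbedding.subtype_coe hΩ.measurableSet).measurableSet_image.2
    hclosed.measurableSet using 1
  ext x
  simp [tangentSet, and_comm]

/-- The gradients at points of the tangent set fill a ball. -/
theorem ball_subset_gradient_image {Ω : Set Plane} {u : Plane → ℝ} {z x₀ : Plane}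
    (hΩ : IsOpen Ω) (hb : Bornology.IsBounded Ω) (hc : ContinuousOn u (closure Ω))
    (hu : ContDiffOn ℝ 2 u Ω) (hfr : ∀ x ∈ frontier Ω, 0 ≤ u x)
    (hz : Ω ⊆ Metric.ball z (2 * Metric.diam Ω)) (hx₀ : x₀ ∈ Ω) :
    Metric.ball (0 : Plane) (-u x₀ / (4 * Metric.diam Ω)) ⊆
      (fun x => vecOfDual (fderiv ℝ u x)) ''
        tangentSet Ω (Metric.ball z (2 * Metric.diam Ω)) u := by
  intro p hp
  set d := Metric.diam Ω with hd_def
  have hd : 0 < d := by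
    have := hz hx₀
    have := Metric.pos_of_mem_ball this
    linarith
  rw [mem_ball_zero_iff, lt_div_iff₀ (by positivity)] at hp
  have hinner : ∀ y : Plane, ∀ r : ℝ, dist y x₀ ≤ r → |inner ℝ p (y - x₀)| ≤ ‖p‖ * r :=
    fun y r hr => (abs_real_inner_le_norm _ _).trans <| by
      rw [← dist_eq_norm]; gcongr
  have hcomp : IsCompact (closure Ω) := hb.isCompact_closure
  have hcv : ContinuousOn (fun y => u y - inner ℝ p (y - x₀)) (closure Ω) :=
    hc.sub (by fun_prop)
  obtain ⟨x₁, hx₁, hmin⟩ := hcomp.exists_isMinOn ⟨x₀, subset_closure hx₀⟩ hcv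
  have hval : u x₁ - inner ℝ p (x₁ - x₀) ≤ u x₀ := by
    simpa using hmin (subset_closure hx₀)
  -- On the frontier the minimum would be at least `-‖p‖ d`, which exceeds `u x₀`.
  have hx₁Ω : x₁ ∈ Ω := by
    by_contra hn
    have hf := hfr x₁ (by rw [hΩ.frontier_eq]; exact ⟨hx₁, hn⟩)
    have hdist : dist x₁ x₀ ≤ d := by
      rw [hd_def, ← Metric.diam_closure]
      exact Metric.dist_le_diam_of_mem hb.closure hx₁ (subset_closure hx₀)
    have := (abs_le.1 (hinner x₁ d hdist)).2
    nlinarith [norm_nonneg p]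
  have hdiff : DifferentiableAt ℝ u x₁ :=
    (hu.contDiffAt (hΩ.mem_nhds hx₁Ω)).differentiableAt (by simp)
  have hgrad : fderiv ℝ u x₁ = innerSL ℝ p := by
    have hloc : IsLocalMin (fun y => u y - inner ℝ p (y - x₀)) x₁ :=
      (hmin.on_subset subset_closure).isLocalMin (hΩ.mem_nhds hx₁Ω)
    have hin : HasFDerivAt (fun y => inner ℝ p (y - x₀)) (innerSL ℝ p) x₁ :=
      (innerSL ℝ p).hasFDerivAt.comp x₁ ((hasFDerivAt_id x₁).sub_const x₀)
    exact sub_eq_zero.1 (hloc.hasFDerivAt_eq_zero (hdiff.hasFDerivAt.sub hin))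
  refine ⟨x₁, ⟨hx₁Ω, fun y hy => ?_⟩, ?_⟩
  · rw [hgrad, innerSL_apply_apply]
    have hsplit : inner ℝ p (y - x₁) = inner ℝ p (y - x₀) - inner ℝ p (x₁ - x₀) := by
      rw [← inner_sub_right]; congr 1; abel
    -- Both points lie in a ball of radius `2d`: this fixes the factor 4 in the radius of slopes and
    -- keeps the plane below 0 on `B`.
    have hdist : dist y x₀ ≤ 4 * d := by
      have := hz hx₀
      rw [Metric.mem_ball] at hy this
      linarith [dist_triangle_right y x₀ z]
    have hnp : u x₁ + inner ℝ p (y - x₁) ≤ 0 := by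
      have := (abs_le.1 (hinner y _ hdist)).2
      linarith
    rw [negPt, le_neg, max_le_iff]
    refine ⟨?_, by linarith⟩
    by_cases hyΩ : y ∈ Ω
    · rw [Set.indicator_of_mem hyΩ]
      have : u x₁ - inner ℝ p (x₁ - x₀) ≤ u y - inner ℝ p (y - x₀) :=
        hmin (subset_closure hyΩ)
      linarith
    · rw [Set.indicator_of_notMem hyΩ]
      linarith
  · simp only [hgrad, vecOfDual_innerSL]

/-! ### Determinant bound and integration -/

/-- On the tangent set, the Hessian determinant is controlled by the right-hand side. -/
theorem abs_det_hessian_le {lam Lam : ℝ} {Ω B : Set Plane} {a₁₁ a₁₂ a₂₂ u f : Plane → ℝ}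
    {x : Plane} (hlam : 0 < lam) (hΩ : IsOpen Ω) (hΩB : Ω ⊆ B)
    (hell : IsElliptic lam Lam Ω a₁₁ a₁₂ a₂₂) (hu : ContDiffOn ℝ 2 u Ω)
    (hL : ∀ x ∈ Ω, grushinL a₁₁ a₁₂ a₂₂ u x ≤ f x * x 0 ^ 2)
    (hx : x ∈ tangentSet Ω B u) (hx0 : x 0 ≠ 0) :
    |(vecOfDual.comp (fderiv ℝ (fderiv ℝ u) x)).det| ≤
      (posPt f x ^ 2 * x 0 ^ 2) / (4 * lam ^ 2) := by
  obtain ⟨hxΩ, hxt⟩ := hx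
  have hux := hu.contDiffAt (hΩ.mem_nhds hxΩ)
  have hsymm : ∀ v w, fderiv ℝ (fderiv ℝ u) x v w = fderiv ℝ (fderiv ℝ u) x w v :=
    hux.isSymmSndFDerivAt (by simp)
  have hpsd := fderiv_fderiv_nonneg_of_tangent_le hux (by
    filter_upwards [hΩ.mem_nhds hxΩ] with y hy
    refine (hxt y (hΩB hy)).trans ?_
    rw [negPt, Set.indicator_of_mem hy]
    linarith [le_max_left (-u y) 0])
  have hLx := hL x hxΩ
  rw [grushinL_eq hux] at hLx
  rw [det_vecOfDual_comp, hsymm (EuclideanSpace.single 0 1) (EuclideanSpace.single 1 1)]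
  set H := fderiv ℝ (fderiv ℝ u) x
  set p := H (EuclideanSpace.single 0 1) (EuclideanSpace.single 0 1)
  set q := H (EuclideanSpace.single 1 1) (EuclideanSpace.single 0 1)
  set r := H (EuclideanSpace.single 1 1) (EuclideanSpace.single 1 1)
  obtain ⟨hdet, hT, hmain⟩ := det_mul_le_trace_sq (p := p) (q := q) (r := r) (t := x 0) hlam
    (fun ξ₁ ξ₂ => (hell x hxΩ ξ₁ ξ₂).1) (fun ξ₁ ξ₂ => by
      have h := hpsd (ξ₁ • EuclideanSpace.single 0 1 + ξ₂ • EuclideanSpace.single 1 1)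
      simp only [map_add, map_smul, add_apply,
        smul_apply, smul_eq_mul] at h
      rw [hsymm (EuclideanSpace.single 0 1) (EuclideanSpace.single 1 1)] at h
      change 0 ≤ ξ₁ * (ξ₁ * p + ξ₂ * q) + ξ₂ * (ξ₁ * q + ξ₂ * r) at h
      linarith)
  have hx2 : 0 < x 0 ^ 2 := by positivity
  have hTle := hLx.trans (mul_le_mul_of_nonneg_right (le_max_left (f x) 0) hx2.le)
  have hsq := hmain.trans (pow_le_pow_left₀ hT hTle 2)
  rw [← sq, abs_of_nonneg hdet, le_div_iff₀ (by positivity)]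
  refine le_of_mul_le_mul_right ?_ hx2
  calc _ = 4 * lam ^ 2 * x 0 ^ 2 * (p * r - q ^ 2) := by ring
    _ ≤ _ := hsq
    _ = _ := by rw [posPt]; ring

theorem integrableOn_posPt_sq {Ω : Set Plane} {f : Plane → ℝ} (hΩ : IsOpen Ω)
    (hb : Bornology.IsBounded Ω) (hf : AEMeasurable f (volume.restrict Ω))
    (hK : ∃ K : ℝ, ∀ x ∈ Ω, |f x| ≤ K) :
    IntegrableOn (fun x => posPt f x ^ 2 * x 0 ^ 2) Ω := by
  obtain ⟨K, hK⟩ := hK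
  obtain ⟨R, hR⟩ := hb.exists_norm_le
  have hmeas : AEStronglyMeasurable (fun x => posPt f x ^ 2 * x 0 ^ 2) (volume.restrict Ω) := by
    have h0 : Measurable fun x : Plane => x 0 := by fun_prop
    exact (((hf.max aemeasurable_const).pow_const 2).mul
      (h0.aemeasurable.pow_const 2)).aestronglyMeasurable
  have hfin : IsFiniteMeasure (volume.restrict Ω) := ⟨by simpa using hb.measure_lt_top⟩
  refine Integrable.of_bound hmeas (K ^ 2 * R ^ 2) ?_
  filter_upwards [ae_restrict_mem hΩ.measurableSet] with x hx
  have h1 : posPt f x ≤ K :=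
    max_le ((le_abs_self _).trans (hK x hx)) ((abs_nonneg _).trans (hK x hx))
  have h2 : |x 0| ≤ R := (PiLp.norm_apply_le x 0).trans (hR x hx)
  have h3 : 0 ≤ posPt f x := le_max_right _ _
  rw [Real.norm_of_nonneg (by positivity), ← sq_abs (x 0)]
  gcongr

/-- The estimate at a single point of negativity. -/
theorem neg_le_of_grushinL_le {lam Lam : ℝ} {Ω : Set Plane} {a₁₁ a₁₂ a₂₂ u f : Plane → ℝ}
    {z x₀ : Plane} (hlam : 0 < lam)
    (hΩ : IsOpen Ω) (hb : Bornology.IsBounded Ω)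
    (hell : IsElliptic lam Lam Ω a₁₁ a₁₂ a₂₂)
    (hc : ContinuousOn u (closure Ω)) (hu : ContDiffOn ℝ 2 u Ω)
    (hfr : ∀ x ∈ frontier Ω, 0 ≤ u x)
    (hf : AEMeasurable f (volume.restrict Ω)) (hK : ∃ K : ℝ, ∀ x ∈ Ω, |f x| ≤ K)
    (hL : ∀ x ∈ Ω, grushinL a₁₁ a₁₂ a₂₂ u x ≤ f x * x 0 ^ 2)
    (hz : Ω ⊆ Metric.ball z (2 * Metric.diam Ω)) (hx₀ : x₀ ∈ Ω) :
    -u x₀ ≤ 2 / (lam * √Real.pi) * Metric.diam Ω *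
      √(∫ x in contactSet Ω (Metric.ball z (2 * Metric.diam Ω)) u,
        posPt f x ^ 2 * x 0 ^ 2) := by
  set B := Metric.ball z (2 * Metric.diam Ω)
  rcases le_or_gt 0 (u x₀) with h0 | h0
  · exact (neg_nonpos.2 h0).trans (mul_nonneg (by positivity) (Real.sqrt_nonneg _))
  have hd : 0 < Metric.diam Ω := by
    have := Metric.pos_of_mem_ball (hz hx₀)
    linarith
  have hint := integrableOn_posPt_sq hΩ hb hf hK
  have hcΩ : contactSet Ω B u ⊆ Ω := fun x hx => hx.1
  have hSc := tangentSet_subset_contactSet (B := B) hz u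
  have hSm := measurableSet_tangentSet (B := B) hΩ hu
  set S := tangentSet Ω B u
  have hSΩ : S ⊆ Ω := hSc.trans hcΩ
  have hnn : ∀ x : Plane, 0 ≤ posPt f x ^ 2 * x 0 ^ 2 := fun x => by positivity
  have hSint : IntegrableOn (fun x => posPt f x ^ 2 * x 0 ^ 2) S := hint.mono_set hSΩ
  have hvol : volume (Metric.ball (0 : Plane) (-u x₀ / (4 * Metric.diam Ω))) ≤
      ENNReal.ofReal (∫ x in S, (posPt f x ^ 2 * x 0 ^ 2) / (4 * lam ^ 2)) := by
    calc _ ≤ volume ((fun x => vecOfDual (fderiv ℝ u x)) '' S) :=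
          measure_mono (ball_subset_gradient_image hΩ hb hc hu hfr hz hx₀)
      _ ≤ ∫⁻ x in S, ENNReal.ofReal |(vecOfDual.comp (fderiv ℝ (fderiv ℝ u) x)).det| := by
          -- Only the inequality is needed, so the gradient map need not be injective.
          refine addHaar_image_le_lintegral_abs_det_fderiv volume hSm fun x hx => ?_
          have hux := hu.contDiffAt (hΩ.mem_nhds (hSΩ hx))
          have hu' : DifferentiableAt ℝ (fderiv ℝ u) x :=
            (hux.fderiv_right (m := 1) (by norm_num)).differentiableAt (by simp)
          exact (vecOfDual.hasFDerivAt.comp x hu'.hasFDerivAt).hasFDerivWithinAt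
      _ ≤ ∫⁻ x in S, ENNReal.ofReal ((posPt f x ^ 2 * x 0 ^ 2) / (4 * lam ^ 2)) := by
          refine lintegral_mono_ae ?_
          have hae : ∀ᵐ x : Plane, x 0 ≠ 0 := by
            rw [ae_iff]; simpa using volume_degenerate_line
          filter_upwards [ae_restrict_mem hSm, ae_restrict_of_ae hae] with x hx hx0
          exact ENNReal.ofReal_le_ofReal (abs_det_hessian_le hlam hΩ hz hell hu hL hx hx0)
      _ = _ := (ofReal_integral_eq_lintegral_ofReal (hSint.div_const _)
          (ae_of_all _ fun x => div_nonneg (hnn x) (by positivity))).symm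
  have hmono : ∫ x in S, posPt f x ^ 2 * x 0 ^ 2 ≤
      ∫ x in contactSet Ω B u, posPt f x ^ 2 * x 0 ^ 2 :=
    setIntegral_mono_set (hint.mono_set hcΩ) (ae_of_all _ hnn) hSc.eventuallyLE
  set I := ∫ x in contactSet Ω B u, posPt f x ^ 2 * x 0 ^ 2
  have hr : 0 ≤ -u x₀ / (4 * Metric.diam Ω) := div_nonneg (by linarith) (by positivity)
  rw [integral_div, EuclideanSpace.volume_ball_fin_two, ← ENNReal.ofReal_pow hr,
    ← ENNReal.ofReal_mul (by positivity),
    ENNReal.ofReal_le_ofReal_iff (div_nonneg (integral_nonneg hnn) (by positivity))] at hvol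
  have hI : 0 ≤ I := (integral_nonneg hnn).trans hmono
  have hmain : (-u x₀ / (4 * Metric.diam Ω)) ^ 2 * Real.pi ≤ I / (4 * lam ^ 2) := by
    refine le_trans ?_ (hvol.trans (by gcongr))
    linarith
  -- Solving `π (-u x₀ / (4d))² ≤ I / (4 lam²)` for `-u x₀` gives the constant `2 / (lam √π)`.
  refine abs_le_of_sq_le_sq' ?_ (by positivity) |>.2
  have hpi := Real.pi_pos
  rw [mul_pow, mul_pow, div_pow, mul_pow, Real.sq_sqrt hpi.le, Real.sq_sqrt hI]
  rw [div_pow, div_mul_eq_mul_div, div_le_div_iff₀ (by positivity) (by positivity)] at hmain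
  rw [div_mul_eq_mul_div, div_mul_eq_mul_div, le_div_iff₀ (by positivity)]
  nlinarith

end GrushinABP

theorem theorem2p3 (lam Lam : ℝ) (hlam : 0 < lam) (hLam : 0 < Lam) :
    ∃ C : ℝ, 0 < C ∧
      ∀ (Ω : Set GrushinABP.Plane), IsOpen Ω → Bornology.IsBounded Ω →
      ∀ (a₁₁ a₁₂ a₂₂ : GrushinABP.Plane → ℝ),
        GrushinABP.IsElliptic lam Lam Ω a₁₁ a₁₂ a₂₂ →
      ∀ (u f : GrushinABP.Plane → ℝ),
        ContinuousOn u (closure Ω) → ContDiffOn ℝ 2 u Ω →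
        (∀ x ∈ frontier Ω, 0 ≤ u x) →
        AEMeasurable f (volume.restrict Ω) → (∃ K : ℝ, ∀ x ∈ Ω, |f x| ≤ K) →
        (∀ x ∈ Ω, GrushinABP.grushinL a₁₁ a₁₂ a₂₂ u x ≤ f x * x 0 ^ 2) →
      ∀ z : GrushinABP.Plane, Ω ⊆ Metric.ball z (2 * Metric.diam Ω) →
        BddAbove (GrushinABP.negPt u '' Ω) ∧
        sSup (GrushinABP.negPt u '' Ω) ≤
          C * Metric.diam Ω *
            Real.sqrt (∫ x in GrushinABP.contactSet Ω (Metric.ball z (2 * Metric.diam Ω)) u,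
              GrushinABP.posPt f x ^ 2 * x 0 ^ 2) := by
  refine ⟨2 / (lam * √Real.pi), by positivity, ?_⟩
  intro Ω hΩ hb a₁₁ a₁₂ a₂₂ hell u f hc hu hfr hf hK hL z hz
  have hnn : 0 ≤ 2 / (lam * √Real.pi) * Metric.diam Ω *
      √(∫ x in GrushinABP.contactSet Ω (Metric.ball z (2 * Metric.diam Ω)) u,
        GrushinABP.posPt f x ^ 2 * x 0 ^ 2) :=
    mul_nonneg (by positivity) (Real.sqrt_nonneg _)
  have hle : ∀ t ∈ GrushinABP.negPt u '' Ω, t ≤ 2 / (lam * √Real.pi) * Metric.diam Ω *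
      √(∫ x in GrushinABP.contactSet Ω (Metric.ball z (2 * Metric.diam Ω)) u,
        GrushinABP.posPt f x ^ 2 * x 0 ^ 2) := by
    rintro _ ⟨x, hx, rfl⟩
    exact max_le (GrushinABP.neg_le_of_grushinL_le hlam hΩ hb hell hc hu hfr hf hK hL hz hx) hnn
  -- Nonnegativity of the bound covers empty `Ω`, where `sSup ∅ = 0`.
  exact ⟨⟨_, hle⟩, Real.sSup_le hle hnn⟩
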